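/- Let $n\ge 1$. A lattice point $x\in\mathbb Z^n$ is visible if $\gcd(x_1,\dots,x_n)=1$. For $\Delta\subseteq\mathbb R^n$, the (asymptotic) density of visible points in $\Delta$ is $$\rho(\Delta)=\lim_{r\to\infty}\frac{\#\{x\in\Delta\cap[-r,r]^n\cap\mathbb Z^n:\ x\text{ visible}\}}{\#(\Delta\cap[-r,r]^n\cap\mathbb Z^n)},$$ if the limit exists. Let $p_1,\dots,p_n\in\mathbb Z^n$ be in general position in $\mathbb R^n$ (that is, affinely independent), let $\mathcal H$ be the hyperplane containing them, and let $d$ be the determinant of the matrix with rows $p_1,\dots,p_n$. Then $\mathcal H$ has the equation $$\det\begin{pmatrix}p_{11}&\cdots&p_{1n}&1\\ \vdots&&\vdots&\vdots\\ p_{n1}&\cdots&p_{nn}&1\\ x_1&\cdots&x_n&1\end{pmatrix}=a_1x_1+\cdots+a_nx_n+d=0,\qquad a_j\in\mathbb Z .$$ Let $g=\gcd(a_1,\dots,a_n)$; it is positive and divides $d$. (i) If this equation is primitive, that is, if $g=1$, then the density of visible points on $\mathcal H$ exists and $$\rho(\mathcal H)=\prod_{p\mid d}\Bigl(1-\frac1{p^{\,n-1}}\Bigr).$$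 (ii) In general, when the equation is made primitive by dividing it by $g$, the density of visible points on $\mathcal H$ exists and $$\rho(\mathcal H)=\prod_{p\mid d/g}\Bigl(1-\frac1{p^{\,n-1}}\Bigr).$$ The products are over the prime divisors; if $d=0$, they are over all primes. -/

import Mathlib

open Filter Topology

/-- A point of `ℤ^n`, regarded as a point of `ℝ^n`. -/
def toRealPoint {n : ℕ} (x : Fin n → ℤ) : Fin n → ℝ := fun i => (x i : ℝ)

/-- The lattice points of `Δ` in the cube `[-r, r]^n`. -/
def latticePointsIn {n : ℕ} (Δ : Set (Fin n → ℝ)) (r : ℝ) : Set (Fin n → ℤ) :=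
  {x | toRealPoint x ∈ Δ ∧ ∀ i, (x i : ℝ) ∈ Set.Icc (-r) r}

/-- A lattice point is visible if the gcd of its coordinates is `1`. -/
def IsVisiblePoint {n : ℕ} (x : Fin n → ℤ) : Prop := Finset.univ.gcd x = 1

/-- The visible lattice points of `Δ` in the cube `[-r, r]^n`. -/
def visiblePointsIn {n : ℕ} (Δ : Set (Fin n → ℝ)) (r : ℝ) : Set (Fin n → ℤ) :=
  {x | x ∈ latticePointsIn Δ r ∧ IsVisiblePoint x}

/-- The asymptotic density of visible points in `Δ` exists and equals `ρ`. -/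
def HasVisibleDensity {n : ℕ} (Δ : Set (Fin n → ℝ)) (ρ : ℝ) : Prop :=
  Tendsto (fun r : ℝ =>
    ((visiblePointsIn Δ r).ncard : ℝ) / ((latticePointsIn Δ r).ncard : ℝ)) atTop (𝓝 ρ)

/-- `n` integral points of `ℝ^n` are in general position if they are affinely independent
over `ℝ`, that is, if exactly one hyperplane contains them. -/
def InGeneralPosition {n : ℕ} (p : Fin n → Fin n → ℤ) : Prop :=
  AffineIndependent ℝ (fun i => toRealPoint (p i))

/-- The hyperplane through `n` points in general position: their affine span. -/
def hyperplaneThrough {n : ℕ} (p : Fin n → Fin n → ℤ) : Set (Fin n → ℝ) :=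
  affineSpan ℝ (Set.range fun i => toRealPoint (p i))

/-- The matrix with rows `(p i, 1)` and last row `(x, t)`. For `t = 1` its determinant,
equated to `0`, is an equation in `x` of the hyperplane through the `p i`. -/
def borderedMatrix {n : ℕ} (p : Fin n → Fin n → ℤ) (x : Fin n → ℤ) (t : ℤ) :
    Matrix (Fin n ⊕ Unit) (Fin n ⊕ Unit) ℤ :=
  Matrix.fromBlocks (Matrix.of p) (Matrix.of fun _ _ => 1) (Matrix.of fun _ j => x j)
    (Matrix.of fun _ _ => t)

/-- The coefficient of `x j` in the linear polynomial `det (borderedMatrix p x 1)`. -/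
def hyperplaneCoeff {n : ℕ} (p : Fin n → Fin n → ℤ) (j : Fin n) : ℤ :=
  (borderedMatrix p (Pi.single j 1) 0).det

/-- The polynomial `det (borderedMatrix p x 1)`, expanded: its coefficients are the
`hyperplaneCoeff p j` and its constant term is the determinant with rows `p i`. -/
theorem det_borderedMatrix {n : ℕ} (p : Fin n → Fin n → ℤ) (x : Fin n → ℤ) :
    (borderedMatrix p x 1).det = ∑ j, hyperplaneCoeff p j * x j + (Matrix.of p).det := by
  have key : ∀ (x : Fin n → ℤ) (t : ℤ), borderedMatrix p x t =
      (borderedMatrix p 0 0).updateRow (Sum.inr ()) (Sum.elim x fun _ => t) := by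
    intro x t
    ext i j
    rcases i with i | ⟨⟩ <;> rcases j with j | ⟨⟩ <;>
      simp [borderedMatrix, Matrix.updateRow_apply]
  have h0 : (borderedMatrix p 0 1).det = (Matrix.of p).det := by
    have : borderedMatrix p 0 1 =
        Matrix.fromBlocks (Matrix.of p) (Matrix.of fun _ _ => 1) 0 1 := by
      ext i j
      rcases i with i | ⟨⟩ <;> rcases j with j | ⟨⟩ <;> simp [borderedMatrix]
    rw [this, Matrix.det_fromBlocks_zero₂₁]
    simp
  have hs : (Sum.elim x (fun _ : Unit => (1 : ℤ))) =
      ∑ j, x j • Sum.elim (Pi.single j 1 : Fin n → ℤ) (fun _ : Unit => (0 : ℤ)) +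
        Sum.elim (0 : Fin n → ℤ) (fun _ => 1) := by
    ext i
    rcases i with i | ⟨⟩ <;> simp [Finset.sum_apply, Pi.single_apply]
  rw [key, hs, Matrix.det_updateRow_add, ← key, h0]
  congr 1
  refine (map_sum ((Matrix.detRowAlternating (R := ℤ)
    (n := Fin n ⊕ Unit)).toMultilinearMap.toLinearMap (borderedMatrix p 0 0) (Sum.inr ()))
    (fun j => x j • Sum.elim (Pi.single j 1 : Fin n → ℤ) (fun _ : Unit => (0 : ℤ)))
    Finset.univ).trans (Finset.sum_congr rfl fun j _ => ?_)
  rw [map_smul, hyperplaneCoeff, key (Pi.single j 1) 0, smul_eq_mul, mul_comm]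
  rfl

/-- The (nonnegative) gcd of the coefficients of the `x j` in that polynomial. -/
def coeffGcd {n : ℕ} (p : Fin n → Fin n → ℤ) : ℤ := Finset.univ.gcd (hyperplaneCoeff p)

/-- The primes dividing the integer `d`; these are all primes if `d = 0`. -/
def primesDividing (d : ℤ) : Set ℕ := {q | q.Prime ∧ (q : ℤ) ∣ d}

/-! After division by `g`, the lattice points of the hyperplane are the integer solutions of a
primitive equation `a·x + d = 0`. Put `m = n - 1`. The kernel of `a` is a lattice of rank `m`, so
its count in the cube grows like `V * r ^ m`; translation by an integer solution gives every `d` the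
same `V` (`tendsto_card_latticeSlice`). A common divisor `k` of the coordinates of a solution
divides `d`, and the solutions divisible by `k` are `k` times those for `d / k` in a cube of radius
`r / k`: a proportion `1 / k ^ m`. Inclusion-exclusion over a finite set `T` of primes dividing `d`
yields the partial product over `T`.

Visible points avoid every prime, so the partial products bound the density from above. If `∑ 1 / q
^ m` converges, the points lost to primes outside `T` are controlled by a tail of this series
(`ncard_not_dvd_le_ncard_visible_add`). If it diverges, the product is `0` and the upper bound
suffices. -/

/-! ### The integral equation of the hyperplane -/

theorem vecMul_borderedMatrix_map {n : ℕ} (p : Fin n → Fin n → ℤ) (x : Fin n → ℤ)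
    (v : Fin n ⊕ Unit → ℝ) :
    Matrix.vecMul v ((borderedMatrix p x 1).map (Int.castRingHom ℝ)) = 0 ↔
      ∑ i, v (Sum.inl i) • toRealPoint (p i) + v (Sum.inr ()) • toRealPoint x = 0 ∧
      ∑ i, v (Sum.inl i) + v (Sum.inr ()) = 0 := by
  simp [funext_iff, Matrix.vecMul, dotProduct, borderedMatrix, toRealPoint]

/-- A left null vector of the bordered matrix is an affine dependence between `x` and the `p i`.
Independence of the `p i` makes the weight of `x` nonzero, so one can solve for `x`. -/
theorem toRealPoint_mem_hyperplaneThrough_iff {n : ℕ} {p : Fin n → Fin n → ℤ}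
    (hp : InGeneralPosition p) (x : Fin n → ℤ) :
    toRealPoint x ∈ hyperplaneThrough p ↔
      ∑ j, hyperplaneCoeff p j * x j + (Matrix.of p).det = 0 := by
  rw [← det_borderedMatrix, ← Int.cast_eq_zero (α := ℝ), ← eq_intCast (Int.castRingHom ℝ), RingHom.map_det,
    ← Matrix.exists_vecMul_eq_zero_iff]
  simp only [RingHom.mapMatrix_apply, vecMul_borderedMatrix_map]
  constructor
  · intro hx
    obtain ⟨w, hw, hx⟩ := eq_affineCombination_of_mem_affineSpan_of_fintype hx
    rw [Finset.affineCombination_eq_linear_combination _ _ _ hw] at hx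
    refine ⟨Sum.elim w fun _ => -1, fun h => ?_, ?_, ?_⟩
    · simpa using congrFun h (Sum.inr ())
    · simp [hx]
    · simp [hw]
  · rintro ⟨v, hv, h1, h2⟩
    set t := v (Sum.inr ()) with ht
    have ht0 : t ≠ 0 := by
      intro h0
      rw [h0] at h1 h2
      have := affineIndependent_iff.1 hp Finset.univ (fun i => v (Sum.inl i))
        (by simpa using h2) (by simpa using h1)
      apply hv
      funext i
      rcases i with i | ⟨⟩
      · exact this i (Finset.mem_univ i)
      · exact h0
    have hw : ∑ i, -(t⁻¹ * v (Sum.inl i)) = 1 := by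
      rw [Finset.sum_neg_distrib, ← Finset.mul_sum, eq_neg_of_add_eq_zero_left h2]
      field_simp
    have hx : toRealPoint x = ∑ i, (-(t⁻¹ * v (Sum.inl i))) • toRealPoint (p i) := by
      simp only [neg_smul, mul_smul, Finset.sum_neg_distrib, ← Finset.smul_sum]
      rw [eq_neg_of_add_eq_zero_left h1, smul_neg, neg_neg, smul_smul, inv_mul_cancel₀ ht0,
        one_smul]
    have := affineCombination_mem_affineSpan hw fun i => toRealPoint (p i)
    rw [Finset.affineCombination_eq_linear_combination _ _ _ hw, ← hx] at this
    exact this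

theorem hyperplaneCoeff_dot_self {n : ℕ} {p : Fin n → Fin n → ℤ}
    (hp : InGeneralPosition p) (i : Fin n) :
    ∑ j, hyperplaneCoeff p j * p i j + (Matrix.of p).det = 0 :=
  (toRealPoint_mem_hyperplaneThrough_iff hp (p i)).1
    (subset_affineSpan ℝ _ (Set.mem_range_self i))

theorem coeffGcd_dvd_det {n : ℕ} (hn : 1 ≤ n) {p : Fin n → Fin n → ℤ}
    (hp : InGeneralPosition p) : coeffGcd p ∣ (Matrix.of p).det := by
  have h := hyperplaneCoeff_dot_self hp ⟨0, hn⟩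
  rw [eq_neg_of_add_eq_zero_right h, dvd_neg]
  exact Finset.dvd_sum fun j _ => (Finset.gcd_dvd (Finset.mem_univ j)).mul_right _

/-- Were all coefficients zero, `d` would vanish too and every lattice point would satisfy the
equation; the direction of the span would then be the whole space, but its dimension is `n - 1`. -/
theorem coeffGcd_ne_zero {n : ℕ} (hn : 1 ≤ n) {p : Fin n → Fin n → ℤ}
    (hp : InGeneralPosition p) : coeffGcd p ≠ 0 := by
  intro h0
  have hc : ∀ j, hyperplaneCoeff p j = 0 := fun j => Finset.gcd_eq_zero_iff.1 h0 j (Finset.mem_univ j)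
  have hd : (Matrix.of p).det = 0 := zero_dvd_iff.1 (h0 ▸ coeffGcd_dvd_det hn hp)
  have hall : ∀ x : Fin n → ℤ, toRealPoint x ∈ hyperplaneThrough p := fun x => by
    rw [toRealPoint_mem_hyperplaneThrough_iff hp]; simp [hc, hd]
  obtain ⟨m, rfl⟩ := Nat.exists_eq_add_of_le' hn
  have hrank := AffineIndependent.finrank_vectorSpan hp (n := m) (by simp)
  have htop : vectorSpan ℝ (Set.range fun i => toRealPoint (p i)) = ⊤ := by
    rw [eq_top_iff, ← (Pi.basisFun ℝ (Fin (m + 1))).span_eq, Submodule.span_le]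
    rintro _ ⟨j, rfl⟩
    rw [← direction_affineSpan]
    have := AffineSubspace.vsub_mem_direction (hall (Pi.single j 1)) (hall 0)
    have he : (Pi.basisFun ℝ (Fin (m + 1))) j =
        toRealPoint (Pi.single j 1) -ᵥ toRealPoint (0 : Fin (m + 1) → ℤ) := by
      ext k
      simp [toRealPoint, Pi.single_apply]
    rw [he]
    exact this
  rw [htop] at hrank
  simp at hrank

/-! ### Counting lattice points on a slice -/

/-- The lattice points of the cube `[-r, r]^n` on the hyperplane `a₁x₁ + ⋯ + aₙxₙ + d = 0`. -/
def latticeSlice {n : ℕ} (a : Fin n → ℤ) (d : ℤ) (r : ℝ) : Set (Fin n → ℤ) :=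
  {x | ∑ j, a j * x j + d = 0 ∧ ∀ i, (x i : ℝ) ∈ Set.Icc (-r) r}

theorem exists_dot_eq_one {n : ℕ} {a : Fin n → ℤ} (ha : Finset.univ.gcd a = 1) :
    ∃ c : Fin n → ℤ, ∑ j, a j * c j = 1 := by
  obtain ⟨c, hc⟩ := Finset.gcd_eq_sum_mul Finset.univ a
  exact ⟨c, by rw [← hc, ha]⟩

/-- The integer solutions of a primitive homogeneous linear equation are parametrized by a
matrix with a left inverse. -/
theorem exists_kernel_parametrization {m : ℕ} {a : Fin (m + 1) → ℤ}
    (ha : Finset.univ.gcd a = 1) :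
    ∃ (B : Matrix (Fin (m + 1)) (Fin m) ℤ) (R : Matrix (Fin m) (Fin (m + 1)) ℤ), R * B = 1 ∧
      ∀ x, ∑ j, a j * x j = 0 ↔ ∃ y, B.mulVec y = x := by
  obtain ⟨c, hc⟩ := exists_dot_eq_one ha
  let f : (Fin (m + 1) → ℤ) →ₗ[ℤ] ℤ := ∑ j, a j • LinearMap.proj j
  have hf : ∀ x, f x = ∑ j, a j * x j := fun x => by simp [f]
  have hfc : f c = 1 := by rw [hf, hc]
  have hsurj : Function.Surjective f := fun k => ⟨k • c, by rw [map_smul, hfc, smul_eq_mul, mul_one]⟩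
  have hrank : Module.finrank ℤ (LinearMap.ker f) = m := by
    have h1 := Submodule.finrank_quotient_add_finrank (LinearMap.ker f)
    have h2 := (f.quotKerEquivOfSurjective hsurj).finrank_eq
    simp at h1 h2
    omega
  let b := Module.finBasisOfFinrankEq ℤ (LinearMap.ker f) hrank
  -- Since `f c = 1`, the map `x ↦ x - f x • c` is an integral projection onto the kernel; it
  -- supplies the left inverse.
  let π : (Fin (m + 1) → ℤ) →ₗ[ℤ] LinearMap.ker f :=
    (LinearMap.id - f.smulRight c).codRestrict _ fun x => by
      rw [LinearMap.mem_ker, LinearMap.sub_apply, map_sub, LinearMap.smulRight_apply, map_smul, hfc]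
      simp
  have hπ : ∀ x (hx : x ∈ LinearMap.ker f), π x = ⟨x, hx⟩ := fun x hx => by
    ext1
    simp [π, LinearMap.mem_ker.1 hx]
  let i : (Fin m → ℤ) →ₗ[ℤ] (Fin (m + 1) → ℤ) := (LinearMap.ker f).subtype ∘ₗ b.equivFun.symm
  let s : (Fin (m + 1) → ℤ) →ₗ[ℤ] (Fin m → ℤ) := b.equivFun ∘ₗ π
  refine ⟨LinearMap.toMatrix' i, LinearMap.toMatrix' s, ?_, fun x => ?_⟩
  · rw [← LinearMap.toMatrix'_comp, ← LinearMap.toMatrix'_id]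
    congr 1
    refine LinearMap.ext fun y => ?_
    have := hπ (b.equivFun.symm y) (b.equivFun.symm y).2
    simp only [i, s, LinearMap.comp_apply, Submodule.subtype_apply, LinearEquiv.coe_coe, this]
    exact b.equivFun.apply_symm_apply y
  · simp only [LinearMap.toMatrix'_mulVec, ← hf]
    constructor
    · intro hx
      exact ⟨b.equivFun ⟨x, hx⟩, by simp [i, -Module.Basis.equivFun_apply]⟩
    · rintro ⟨y, rfl⟩
      exact (b.equivFun.symm y).2

theorem finite_latticeSlice {n : ℕ} (a : Fin n → ℤ) (d : ℤ) (r : ℝ) :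
    (latticeSlice a d r).Finite := by
  refine (Set.Finite.pi' fun _ : Fin n => Set.finite_Icc (-⌊r⌋) ⌊r⌋).subset ?_
  rintro x ⟨-, hx⟩ i
  have := hx i
  constructor
  · have : (-x i) ≤ ⌊r⌋ := Int.le_floor.2 (by push_cast; linarith [this.1])
    linarith
  · exact Int.le_floor.2 this.2

theorem mem_integerSpan_iff {m : ℕ} (y : Fin m → ℝ) :
    y ∈ Submodule.span ℤ (Set.range (Pi.basisFun ℝ (Fin m))) ↔ ∃ z, toRealPoint z = y := by
  rw [Module.Basis.mem_span_iff_repr_mem]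
  simp only [Pi.basisFun_repr, Set.mem_range, algebraMap_int_eq, Int.coe_castRingHom]
  constructor
  · intro h
    choose z hz using h
    exact ⟨z, funext hz⟩
  · rintro ⟨z, rfl⟩ i
    exact ⟨z i, rfl⟩

open scoped Pointwise in
-- In kernel coordinates `y`, this counts integer points in dilates of the convex body of `y` with
-- `B y` in the unit cube; `V` is its volume. The left inverse makes the body bounded, and it
-- contains a neighbourhood of `0`.
theorem tendsto_card_latticeSlice_zero {m : ℕ} {a : Fin (m + 1) → ℤ}
    (ha : Finset.univ.gcd a = 1) :
    ∃ V : ℝ, 0 < V ∧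
      Tendsto (fun r : ℝ => ((latticeSlice a 0 r).ncard : ℝ) / r ^ m) atTop (𝓝 V) := by
  obtain ⟨B, R, hRB, hB⟩ := exists_kernel_parametrization ha
  let L : (Fin m → ℝ) →L[ℝ] (Fin (m + 1) → ℝ) :=
    LinearMap.toContinuousLinearMap (Matrix.toLin' (B.map (Int.cast : ℤ → ℝ)))
  let K : (Fin (m + 1) → ℝ) →L[ℝ] (Fin m → ℝ) :=
    LinearMap.toContinuousLinearMap (Matrix.toLin' (R.map (Int.cast : ℤ → ℝ)))
  have hKL : ∀ y, K (L y) = y := fun y => by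
    have : R.map (Int.cast : ℤ → ℝ) * B.map (Int.cast : ℤ → ℝ) = 1 := by
      have := congrArg (fun M => M.map (Int.castRingHom ℝ)) hRB
      rwa [Matrix.map_mul, Matrix.map_one _ (map_zero _) (map_one _)] at this
    simp [K, L, Matrix.mulVec_mulVec, this]
  have hLz : ∀ z : Fin m → ℤ, L (toRealPoint z) = toRealPoint (B.mulVec z) := fun z => by
    ext i
    simp [L, toRealPoint, Matrix.mulVec, dotProduct]
  have hBinj : Function.Injective B.mulVec := fun y z h => by
    have := congrArg R.mulVec h
    simpa [Matrix.mulVec_mulVec, hRB] using this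
  have hinj : Function.Injective (toRealPoint : (Fin m → ℤ) → _) := fun y z h => by
    funext i
    exact Int.cast_injective (α := ℝ) (congrFun h i)
  let s : Set (Fin m → ℝ) := L ⁻¹' Metric.closedBall 0 1
  have hconv : Convex ℝ s := (convex_closedBall _ _).linear_preimage L.toLinearMap
  have hclosed : IsClosed s := Metric.isClosed_closedBall.preimage L.continuous
  have h0 : (0 : Fin m → ℝ) ∈ s := by simp [s]
  have hbdd : Bornology.IsBounded s := by
    have : s ⊆ K '' Metric.closedBall 0 1 := fun y hy => ⟨L y, hy, hKL y⟩
    exact (((isCompact_closedBall _ _).image K.continuous).isBounded).subset this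
  have hpos : 0 < MeasureTheory.volume.real s := by
    refine ENNReal.toReal_pos (ne_of_gt ?_) hbdd.measure_lt_top.ne
    refine lt_of_lt_of_le ?_ (MeasureTheory.measure_mono
      (Set.preimage_mono (Metric.ball_subset_closedBall) : L ⁻¹' Metric.ball 0 1 ⊆ s))
    exact (Metric.isOpen_ball.preimage L.continuous).measure_pos _ ⟨0, by simp⟩
  have hmono : ∀ ⦃x y : ℝ⦄, 0 < x → x ≤ y → x • s ⊆ y • s := by
    rintro x y hx hxy _ ⟨z, hz, rfl⟩
    have hy := hx.trans_le hxy
    refine ⟨(x / y) • z, hconv.smul_mem_of_zero_mem h0 hz ⟨by positivity, ?_⟩, ?_⟩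
    · exact div_le_one_of_le₀ hxy hy.le
    · simp only [smul_smul]
      congr 1
      field_simp
  have key := tendsto_card_div_pow_atTop_volume' s hbdd hclosed.measurableSet
    (hconv.addHaar_frontier _) hmono
  refine ⟨_, hpos, key.congr' ?_⟩
  filter_upwards [eventually_gt_atTop 0] with r hr
  rw [Fintype.card_fin, Nat.card_coe_set_eq]
  congr 2
  let D : Set (Fin m → ℤ) := {z | ∀ i, ((B.mulVec z) i : ℝ) ∈ Set.Icc (-r) r}
  have e1 : latticeSlice a 0 r = B.mulVec '' D := by
    ext x
    simp only [latticeSlice, add_zero, Set.mem_ofPred_eq, hB, Set.mem_image, D]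
    constructor
    · rintro ⟨⟨y, rfl⟩, h⟩
      exact ⟨y, h, rfl⟩
    · rintro ⟨y, h, rfl⟩
      exact ⟨⟨y, rfl⟩, h⟩
  have hmem : ∀ z : Fin m → ℤ, r⁻¹ • toRealPoint z ∈ s ↔ z ∈ D := fun z => by
    simp only [s, D, Set.mem_preimage, map_smul, hLz, mem_closedBall_zero_iff, norm_smul,
      norm_inv, Real.norm_of_nonneg hr.le, Set.mem_ofPred_eq]
    rw [inv_mul_le_iff₀ hr, mul_one, pi_norm_le_iff_of_nonneg hr.le]
    simp [toRealPoint, abs_le]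
  have e2 : s ∩ r⁻¹ • (Submodule.span ℤ (Set.range (Pi.basisFun ℝ (Fin m))) : Set (Fin m → ℝ)) =
      (fun z => r⁻¹ • toRealPoint z) '' D := by
    ext y
    simp only [Set.mem_inter_iff, Set.mem_smul_set, SetLike.mem_coe, mem_integerSpan_iff,
      Set.mem_image]
    constructor
    · rintro ⟨hy, _, ⟨z, rfl⟩, rfl⟩
      exact ⟨z, (hmem z).1 hy, rfl⟩
    · rintro ⟨z, hz, rfl⟩
      exact ⟨(hmem z).2 hz, _, ⟨z, rfl⟩, rfl⟩
  rw [e1, e2, Set.ncard_image_of_injective _ hBinj, Set.ncard_image_of_injective]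
  exact (smul_right_injective _ (inv_ne_zero hr.ne')).comp hinj

theorem ncard_latticeSlice_le_of_translate {n : ℕ} {a : Fin n → ℤ} {d e : ℤ} (v : Fin n → ℤ)
    (hv : ∑ j, a j * v j + e = d) {k : ℝ} (hk : ∀ i, |(v i : ℝ)| ≤ k) (r : ℝ) :
    (latticeSlice a d r).ncard ≤ (latticeSlice a e (r + k)).ncard := by
  refine Set.ncard_le_ncard_of_injOn (· + v) ?_ (add_left_injective v).injOn
    (finite_latticeSlice a e _)
  rintro x ⟨hx, hxr⟩
  refine ⟨?_, fun i => ?_⟩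
  · simp only [Pi.add_apply, mul_add, Finset.sum_add_distrib]
    linarith
  · have h1 := hxr i
    have h2 := abs_le.1 (hk i)
    simp only [Pi.add_apply, Int.cast_add, Set.mem_Icc] at h1 ⊢
    constructor <;> linarith [h1.1, h1.2, h2.1, h2.2]

theorem tendsto_add_const_div_pow {f : ℝ → ℝ} {V : ℝ} {m : ℕ}
    (hf : Tendsto (fun r => f r / r ^ m) atTop (𝓝 V)) (k : ℝ) :
    Tendsto (fun r => f (r + k) / r ^ m) atTop (𝓝 V) := by
  have h1 : Tendsto (fun r : ℝ => (r + k) / r) atTop (𝓝 1) := by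
    have : Tendsto (fun r : ℝ => 1 + k / r) atTop (𝓝 (1 + 0)) :=
      tendsto_const_nhds.add (tendsto_const_nhds.div_atTop tendsto_id)
    rw [add_zero] at this
    refine this.congr' ?_
    filter_upwards [eventually_gt_atTop 0] with r hr
    field_simp
  have h2 := (hf.comp (tendsto_atTop_add_const_right atTop k tendsto_id)).mul (h1.pow m)
  rw [one_pow, mul_one] at h2
  refine h2.congr' ?_
  filter_upwards [eventually_gt_atTop 0, eventually_gt_atTop (-k)] with r hr hrk
  have : r + k ≠ 0 := by linarith
  simp only [Function.comp, id, div_pow]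
  field_simp

/-- Translating by `± d * c`, where `a·c = 1`, squeezes the count between those of the homogeneous
slice at radii `r - k` and `r + k`. -/
theorem tendsto_card_latticeSlice {m : ℕ} {a : Fin (m + 1) → ℤ} (ha : Finset.univ.gcd a = 1)
    {V : ℝ} (hV : Tendsto (fun r : ℝ => ((latticeSlice a 0 r).ncard : ℝ) / r ^ m) atTop (𝓝 V))
    (d : ℤ) :
    Tendsto (fun r : ℝ => ((latticeSlice a d r).ncard : ℝ) / r ^ m) atTop (𝓝 V) := by
  obtain ⟨c, hc⟩ := exists_dot_eq_one ha
  have hdc : ∑ j, a j * (d * c j) = d := by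
    simp only [mul_left_comm _ d, ← Finset.mul_sum, hc, mul_one]
  obtain ⟨k, hk⟩ : ∃ k : ℝ, ∀ i, |((d * c i : ℤ) : ℝ)| ≤ k :=
    ⟨∑ i, |((d * c i : ℤ) : ℝ)|, fun i =>
      Finset.single_le_sum (f := fun i => |((d * c i : ℤ) : ℝ)|) (fun _ _ => abs_nonneg _)
        (Finset.mem_univ i)⟩
  refine tendsto_of_tendsto_of_tendsto_of_le_of_le' (tendsto_add_const_div_pow hV (-k))
    (tendsto_add_const_div_pow hV k) ?_ ?_ <;>
  filter_upwards [eventually_gt_atTop 0] with r hr <;>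
    refine div_le_div_of_nonneg_right (Nat.cast_le.2 ?_) (by positivity)
  · refine (ncard_latticeSlice_le_of_translate (e := d) (fun i => -(d * c i)) ?_ (k := k) ?_
      _).trans_eq ?_
    · simp only [mul_neg, Finset.sum_neg_distrib, hdc, neg_add_cancel]
    · intro i
      rw [Int.cast_neg, abs_neg]
      exact hk i
    · rw [neg_add_cancel_right]
  · exact ncard_latticeSlice_le_of_translate (fun i => d * c i) (by rw [hdc, add_zero]) hk r

theorem latticeSlice_mono {n : ℕ} (a : Fin n → ℤ) (d : ℤ) {r s : ℝ} (h : r ≤ s) :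
    latticeSlice a d r ⊆ latticeSlice a d s :=
  fun _ hx => ⟨hx.1, fun i => ⟨(neg_le_neg h).trans (hx.2 i).1, (hx.2 i).2.trans h⟩⟩

/-- The tail estimate needs `C` uniform in `d` and valid for small `r`. A nonempty slice is
translated by one of its own points into the homogeneous slice of radius `2 * r`, whence the factor
`2 ^ m`; for `r < 1` the cube contains only the origin. -/
theorem exists_ncard_latticeSlice_diff_zero_le {m : ℕ} {a : Fin (m + 1) → ℤ} {V : ℝ}
    (hV : Tendsto (fun r : ℝ => ((latticeSlice a 0 r).ncard : ℝ) / r ^ m) atTop (𝓝 V)) :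
    ∃ C : ℝ, 0 ≤ C ∧ ∀ d r, 0 < r → ((latticeSlice a d r \ {0}).ncard : ℝ) ≤ C * r ^ m := by
  obtain ⟨r₀, h₀⟩ := eventually_atTop.1
    ((hV.eventually_le_const (lt_add_one V)).and (eventually_gt_atTop 0))
  set C₀ := max (V + 1) ((latticeSlice a 0 r₀).ncard : ℝ) with hC₀
  have hC₀0 : 0 ≤ C₀ := le_max_of_le_right (Nat.cast_nonneg _)
  have hone : ∀ r, 1 ≤ r → ((latticeSlice a 0 r).ncard : ℝ) ≤ C₀ * r ^ m := by
    intro r hr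
    rcases le_total r₀ r with h | h
    · obtain ⟨h1, h2⟩ := h₀ r h
      rw [div_le_iff₀ (by positivity)] at h1
      exact h1.trans (by gcongr; exact le_max_left _ _)
    · calc ((latticeSlice a 0 r).ncard : ℝ) ≤ (latticeSlice a 0 r₀).ncard := by
            exact_mod_cast Set.ncard_le_ncard (latticeSlice_mono a 0 h) (finite_latticeSlice _ _ _)
        _ ≤ C₀ := le_max_right _ _
        _ ≤ C₀ * r ^ m := le_mul_of_one_le_right hC₀0 (one_le_pow₀ hr)
  refine ⟨C₀ * 2 ^ m, by positivity, fun d r hr => ?_⟩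
  rcases lt_or_ge r 1 with h | h
  · have : latticeSlice a d r \ {0} = ∅ := by
      refine Set.eq_empty_of_forall_notMem fun x ⟨⟨_, hx⟩, hx0⟩ => hx0 (funext fun i => ?_)
      have h1 := abs_le.2 (hx i)
      exact Int.abs_lt_one_iff.1 (by exact_mod_cast h1.trans_lt h)
    rw [this]
    simp only [Set.ncard_empty, Nat.cast_zero]
    positivity
  · rcases (latticeSlice a d r).eq_empty_or_nonempty with he | ⟨y, hy⟩
    · rw [he]
      simp only [Set.empty_sdiff, Set.ncard_empty, Nat.cast_zero]
      positivity
    · have h1 : (latticeSlice a d r \ {0}).ncard ≤ (latticeSlice a d r).ncard :=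
        Set.ncard_le_ncard Set.sdiff_subset (finite_latticeSlice _ _ _)
      have h2 := ncard_latticeSlice_le_of_translate (a := a) (d := d) (e := 0) (fun i => -y i)
        (by simp only [mul_neg, Finset.sum_neg_distrib]; linarith [hy.1]) (k := r)
        (fun i => by rw [Int.cast_neg, abs_neg]; exact abs_le.2 (hy.2 i)) r
      calc ((latticeSlice a d r \ {0}).ncard : ℝ) ≤ (latticeSlice a 0 (r + r)).ncard := by
            exact_mod_cast h1.trans h2
        _ ≤ C₀ * (r + r) ^ m := hone _ (by linarith)
        _ = C₀ * 2 ^ m * r ^ m := by rw [← two_mul, mul_pow]; ring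

/-! ### Divisibility and inclusion-exclusion -/

theorem dvd_of_forall_dvd_of_mem_latticeSlice {n : ℕ} {a : Fin n → ℤ} {d : ℤ} {r : ℝ}
    {x : Fin n → ℤ} (hx : x ∈ latticeSlice a d r) {k : ℤ} (hk : ∀ i, k ∣ x i) : k ∣ d := by
  rw [eq_neg_of_add_eq_zero_right hx.1, dvd_neg]
  exact Finset.dvd_sum fun j _ => (hk j).mul_left _

theorem latticeSlice_dvd_eq_image {n : ℕ} (a : Fin n → ℤ) (e : ℤ) {k : ℕ} (hk : 0 < k)
    (r : ℝ) :
    {x ∈ latticeSlice a (k * e) r | ∀ i, (k : ℤ) ∣ x i} =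
      (fun z i => (k : ℤ) * z i) '' latticeSlice a e (r / k) := by
  have hk' : (0 : ℝ) < k := Nat.cast_pos.2 hk
  have hmem : ∀ z : Fin n → ℤ, (fun i => (k : ℤ) * z i) ∈ latticeSlice a (k * e) r ↔
      z ∈ latticeSlice a e (r / k) := fun z => by
    refine and_congr ?_ (forall_congr' fun i => ?_)
    · simp only [mul_left_comm _ (k : ℤ), ← Finset.mul_sum, ← mul_add]
      rw [mul_eq_zero, or_iff_right (by exact_mod_cast hk.ne')]
    · rw [Int.cast_mul, Int.cast_natCast, Set.mem_Icc, Set.mem_Icc, le_div_iff₀ hk',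
        ← neg_div, div_le_iff₀ hk', mul_comm]
  ext x
  constructor
  · rintro ⟨hx, h⟩
    choose z hz using h
    obtain rfl : x = fun i => (k : ℤ) * z i := funext hz
    exact ⟨z, (hmem z).1 hx, rfl⟩
  · rintro ⟨z, hz, rfl⟩
    exact ⟨(hmem z).2 hz, fun i => dvd_mul_right _ _⟩

theorem injective_natCast_mul {n k : ℕ} (hk : 0 < k) :
    Function.Injective fun (z : Fin n → ℤ) i => (k : ℤ) * z i := fun y z h =>
  funext fun i => mul_left_cancel₀ (by exact_mod_cast hk.ne') (congrFun h i)

theorem tendsto_card_latticeSlice_dvd {m : ℕ} {a : Fin (m + 1) → ℤ}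
    (ha : Finset.univ.gcd a = 1) {V : ℝ}
    (hV : Tendsto (fun r : ℝ => ((latticeSlice a 0 r).ncard : ℝ) / r ^ m) atTop (𝓝 V))
    {d : ℤ} {k : ℕ} (hk : 0 < k) (hkd : (k : ℤ) ∣ d) :
    Tendsto (fun r : ℝ => ({x ∈ latticeSlice a d r | ∀ i, (k : ℤ) ∣ x i}.ncard : ℝ) / r ^ m)
      atTop (𝓝 (V / k ^ m)) := by
  obtain ⟨e, rfl⟩ := hkd
  have hk' : (0 : ℝ) < k := Nat.cast_pos.2 hk
  have h := ((tendsto_card_latticeSlice ha hV e).comp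
    (tendsto_id.atTop_div_const hk')).div_const ((k : ℝ) ^ m)
  refine h.congr' ?_
  filter_upwards [eventually_gt_atTop 0] with r hr
  rw [latticeSlice_dvd_eq_image a e hk, Set.ncard_image_of_injective _ (injective_natCast_mul hk)]
  simp only [Function.comp, id, div_pow]
  field_simp

/-- Expand, at each `x`, the product over `T` of `1` minus the indicator that `q` divides `x`;
distinct primes divide `x` together exactly when their product does. -/
theorem ncard_not_dvd_eq_sum {n : ℕ} {S : Set (Fin n → ℤ)} (hS : S.Finite) {T : Finset ℕ}
    (hT : ∀ q ∈ T, q.Prime) :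
    ({x ∈ S | ∀ q ∈ T, ¬ ∀ i, (q : ℤ) ∣ x i}.ncard : ℝ) =
      ∑ U ∈ T.powerset, (-1) ^ U.card *
        ({x ∈ S | ∀ i, ((∏ q ∈ U, q : ℕ) : ℤ) ∣ x i}.ncard : ℝ) := by
  classical
  have hcard : ∀ P : (Fin n → ℤ) → Prop,
      ({x ∈ S | P x}.ncard : ℝ) = ∑ x ∈ hS.toFinset, if P x then 1 else 0 := fun P => by
    rw [Finset.sum_boole, ← Set.ncard_coe_finset]
    congr 2
    ext x
    simp
  have hdvd : ∀ U ∈ T.powerset, ∀ x : Fin n → ℤ,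
      (∀ i, ((∏ q ∈ U, q : ℕ) : ℤ) ∣ x i) ↔ ∀ q ∈ U, ∀ i, (q : ℤ) ∣ x i := by
    intro U hU x
    rw [Finset.mem_powerset] at hU
    constructor
    · exact fun h q hq i => (Int.natCast_dvd_natCast.2 (Finset.dvd_prod_of_mem _ hq)).trans (h i)
    · intro h i
      rw [Int.natCast_dvd]
      refine Finset.prod_primes_dvd _ (fun q hq => (hT q (hU hq)).prime) fun q hq => ?_
      exact Int.natCast_dvd.1 (h q hq i)
  simp only [hcard, Finset.mul_sum]
  rw [Finset.sum_comm]
  refine Finset.sum_congr rfl fun x _ => ?_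
  have h := Finset.prod_sub (fun _ : ℕ => (1 : ℝ))
    (fun q => if ∀ i, (q : ℤ) ∣ x i then 1 else 0) T
  simp only [Finset.prod_const_one, mul_one, Finset.prod_ite_zero] at h
  refine Eq.trans ?_ (h.trans (Finset.sum_congr rfl fun U hU => ?_))
  · trans ∏ q ∈ T, if ¬ ∀ i, (q : ℤ) ∣ x i then (1 : ℝ) else 0
    · rw [Finset.prod_ite_zero, Finset.prod_const_one]
      congr
    · refine Finset.prod_congr rfl fun q _ => ?_
      by_cases hq : ∀ i, (q : ℤ) ∣ x i
      · rw [if_neg (not_not.2 hq), if_pos hq, sub_self]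
      · rw [if_pos hq, if_neg hq, sub_zero]
  · simp only [hdvd U hU]

theorem tendsto_card_latticeSlice_not_dvd {m : ℕ} {a : Fin (m + 1) → ℤ}
    (ha : Finset.univ.gcd a = 1) {V : ℝ}
    (hV : Tendsto (fun r : ℝ => ((latticeSlice a 0 r).ncard : ℝ) / r ^ m) atTop (𝓝 V))
    {d : ℤ} {T : Finset ℕ} (hT : ∀ q ∈ T, q.Prime) (hTd : ∀ q ∈ T, (q : ℤ) ∣ d) :
    Tendsto (fun r : ℝ =>
      ({x ∈ latticeSlice a d r | ∀ q ∈ T, ¬ ∀ i, (q : ℤ) ∣ x i}.ncard : ℝ) / r ^ m)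
      atTop (𝓝 (V * ∏ q ∈ T, (1 - 1 / (q : ℝ) ^ m))) := by
  classical
  simp only [ncard_not_dvd_eq_sum (finite_latticeSlice a d _) hT, Finset.sum_div, mul_div_assoc]
  rw [Finset.prod_sub, Finset.mul_sum]
  refine tendsto_finsetSum _ fun U hU => ?_
  rw [Finset.mem_powerset] at hU
  have hpos : 0 < ∏ q ∈ U, q := Finset.prod_pos fun q hq => (hT q (hU hq)).pos
  have hd : ((∏ q ∈ U, q : ℕ) : ℤ) ∣ d := by
    rw [Int.natCast_dvd]
    exact Finset.prod_primes_dvd _ (fun q hq => (hT q (hU hq)).prime)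
      fun q hq => Int.natCast_dvd.1 (hTd q (hU hq))
  convert (tendsto_card_latticeSlice_dvd ha hV hpos hd).const_mul ((-1) ^ U.card) using 2
  simp only [Finset.prod_const_one, mul_one, one_div, Finset.prod_inv_distrib,
    Finset.prod_pow, Nat.cast_prod]
  ring

/-! ### Visibility and the tail over the remaining primes -/

theorem ncard_latticeSlice_diff_zero_dvd_le {n m : ℕ} {a : Fin n → ℤ} {C : ℝ}
    (hC : ∀ d r, 0 < r → ((latticeSlice a d r \ {0}).ncard : ℝ) ≤ C * r ^ m)
    {d : ℤ} {k : ℕ} (hk : 0 < k) (hkd : (k : ℤ) ∣ d) {r : ℝ} (hr : 0 < r) :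
    ({x ∈ latticeSlice a d r | x ≠ 0 ∧ ∀ i, (k : ℤ) ∣ x i}.ncard : ℝ) ≤
      C * r ^ m * (1 / (k : ℝ) ^ m) := by
  obtain ⟨e, rfl⟩ := hkd
  have hk' : (0 : ℝ) < k := Nat.cast_pos.2 hk
  have hsub : {x ∈ latticeSlice a (k * e) r | x ≠ 0 ∧ ∀ i, (k : ℤ) ∣ x i} ⊆
      (fun z i => (k : ℤ) * z i) '' (latticeSlice a e (r / k) \ {0}) := by
    rintro x ⟨hx, hx0, hxk⟩
    have hx' : x ∈ {x ∈ latticeSlice a (k * e) r | ∀ i, (k : ℤ) ∣ x i} := ⟨hx, hxk⟩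
    rw [latticeSlice_dvd_eq_image a e hk] at hx'
    obtain ⟨z, hz, rfl⟩ := hx'
    refine ⟨z, ⟨hz, ?_⟩, rfl⟩
    rintro rfl
    exact hx0 (funext fun i => mul_zero _)
  have hfin := (finite_latticeSlice a e (r / k)).subset (Set.sdiff_subset (t := {0}))
  have h := Set.ncard_le_ncard hsub (hfin.image _)
  rw [Set.ncard_image_of_injective _ (injective_natCast_mul hk)] at h
  calc _ ≤ ((latticeSlice a e (r / k) \ {0}).ncard : ℝ) := by exact_mod_cast h
    _ ≤ C * (r / k) ^ m := hC _ _ (by positivity)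
    _ = C * r ^ m * (1 / (k : ℝ) ^ m) := by rw [div_pow]; ring

theorem IsVisiblePoint.eq_one_of_forall_dvd {n : ℕ} {x : Fin n → ℤ} (hx : IsVisiblePoint x)
    {k : ℕ} (hk : ∀ i, (k : ℤ) ∣ x i) : k = 1 := by
  have h : (k : ℤ) ∣ Finset.univ.gcd x := Finset.dvd_gcd fun i _ => hk i
  rw [hx] at h
  exact_mod_cast Int.eq_one_of_dvd_one (Int.natCast_nonneg k) h

theorem exists_prime_dvd_of_not_isVisiblePoint {n : ℕ} {x : Fin n → ℤ}
    (hx : ¬ IsVisiblePoint x) : ∃ q : ℕ, q.Prime ∧ ∀ i, (q : ℤ) ∣ x i := by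
  have hne : (Finset.univ.gcd x).natAbs ≠ 1 := by
    intro h
    refine hx ?_
    have h1 : normalize (Finset.univ.gcd x) = Finset.univ.gcd x := Finset.normalize_gcd
    rw [← Int.abs_eq_normalize, Int.abs_eq_natAbs, h] at h1
    exact h1.symm
  obtain ⟨q, hq, hqd⟩ := Nat.exists_prime_and_dvd hne
  exact ⟨q, hq, fun i => (Int.natCast_dvd.2 hqd).trans (Finset.gcd_dvd (Finset.mem_univ i))⟩

theorem ncard_visible_le_ncard_not_dvd {n : ℕ} (a : Fin n → ℤ) (d : ℤ) (r : ℝ) {T : Finset ℕ}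
    (hT : ∀ q ∈ T, q.Prime) :
    {x ∈ latticeSlice a d r | IsVisiblePoint x}.ncard ≤
      {x ∈ latticeSlice a d r | ∀ q ∈ T, ¬ ∀ i, (q : ℤ) ∣ x i}.ncard :=
  Set.ncard_le_ncard (fun _ hx => ⟨hx.1, fun q hq h =>
    (hT q hq).one_lt.ne' (hx.2.eq_one_of_forall_dvd h)⟩)
    ((finite_latticeSlice a d r).subset fun _ h => h.1)

/-- An invisible point that survives `T` is divisible by a prime of `d` outside `T`. The origin,
divisible by every prime, would spoil the tail sum: it lies on the slice only if `d = 0`, and then a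
nonempty `T` removes it. -/
theorem ncard_not_dvd_le_ncard_visible_add {n m : ℕ} {a : Fin n → ℤ} {C : ℝ} (hC0 : 0 ≤ C)
    (hC : ∀ d r, 0 < r → ((latticeSlice a d r \ {0}).ncard : ℝ) ≤ C * r ^ m)
    {d : ℤ} (hs : Summable fun q : primesDividing d => 1 / ((q : ℕ) : ℝ) ^ m)
    {T : Finset (primesDividing d)} (hT : d = 0 → T.Nonempty) {r : ℝ} (hr : 0 < r) :
    ({x ∈ latticeSlice a d r | ∀ q ∈ T, ¬ ∀ i, ((q : ℕ) : ℤ) ∣ x i}.ncard : ℝ) ≤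
      {x ∈ latticeSlice a d r | IsVisiblePoint x}.ncard +
        C * r ^ m * ∑' q : {q // q ∉ T}, 1 / ((q : ℕ) : ℝ) ^ m := by
  classical
  -- A prime dividing a nonzero point of the cube is at most `r`, so finitely many primes matter.
  have hWfin : {q : {q // q ∉ T} | ((q : ℕ) : ℝ) ≤ r}.Finite := by
    refine Set.Finite.of_finite_image (f := fun q : {q // q ∉ T} => (q : ℕ)) ?_
      (Subtype.val_injective.comp Subtype.val_injective).injOn
    refine (Set.finite_Iic ⌊r⌋₊).subset ?_
    rintro _ ⟨q, hq, rfl⟩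
    exact Nat.le_floor hq
  let W := hWfin.toFinset
  let E : {q // q ∉ T} → Set (Fin n → ℤ) := fun q =>
    {x ∈ latticeSlice a d r | x ≠ 0 ∧ ∀ i, ((q : ℕ) : ℤ) ∣ x i}
  have hsub : {x ∈ latticeSlice a d r | ∀ q ∈ T, ¬ ∀ i, ((q : ℕ) : ℤ) ∣ x i} ⊆
      {x ∈ latticeSlice a d r | IsVisiblePoint x} ∪ ⋃ q ∈ W, E q := by
    rintro x ⟨hx, hxT⟩
    by_cases hv : IsVisiblePoint x
    · exact Or.inl ⟨hx, hv⟩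
    · obtain ⟨q, hq, hqx⟩ := exists_prime_dvd_of_not_isVisiblePoint hv
      have hqd : (q : ℤ) ∣ d := dvd_of_forall_dvd_of_mem_latticeSlice hx hqx
      have hqT : (⟨q, hq, hqd⟩ : primesDividing d) ∉ T := fun h => hxT _ h hqx
      have hx0 : x ≠ 0 := by
        rintro rfl
        have hd : d = 0 := by simpa [latticeSlice] using hx.1
        obtain ⟨q', hq'⟩ := hT hd
        exact hxT q' hq' fun i => dvd_zero _
      obtain ⟨i, hi⟩ := Function.ne_iff.1 hx0
      have hqr : (q : ℝ) ≤ r := by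
        have h1 : (q : ℤ) ≤ |x i| :=
          Int.le_of_dvd (abs_pos.2 hi) ((dvd_abs _ _).2 (hqx i))
        have h2 : ((q : ℤ) : ℝ) ≤ ((|x i| : ℤ) : ℝ) := Int.cast_le.2 h1
        rw [Int.cast_abs, Int.cast_natCast] at h2
        exact h2.trans (abs_le.2 (hx.2 i))
      refine Or.inr (Set.mem_iUnion₂.2 ⟨⟨⟨q, hq, hqd⟩, hqT⟩, ?_, hx, hx0, hqx⟩)
      simpa [W] using hqr
  have hfin : ∀ P : (Fin n → ℤ) → Prop, {x ∈ latticeSlice a d r | P x}.Finite := fun P =>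
    (finite_latticeSlice a d r).subset fun _ h => h.1
  have h1 := (Set.ncard_le_ncard hsub ((hfin _).union
    (Set.Finite.biUnion W.finite_toSet fun q _ => hfin _))).trans (Set.ncard_union_le _ _)
  have h2 : (⋃ q ∈ W, E q).ncard ≤ ∑ q ∈ W, (E q).ncard := Finset.set_ncard_biUnion_le _ _
  have h3 : ∀ q, ((E q).ncard : ℝ) ≤ C * r ^ m * (1 / ((q : ℕ) : ℝ) ^ m) := fun q =>
    ncard_latticeSlice_diff_zero_dvd_le hC q.1.2.1.pos q.1.2.2 hr
  have hs' : Summable fun q : {q // q ∉ T} => 1 / ((q : ℕ) : ℝ) ^ m :=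
    hs.comp_injective Subtype.val_injective
  calc _ ≤ ({x ∈ latticeSlice a d r | IsVisiblePoint x}.ncard : ℝ) +
        ∑ q ∈ W, ((E q).ncard : ℝ) := by exact_mod_cast h1.trans (Nat.add_le_add_left h2 _)
    _ ≤ {x ∈ latticeSlice a d r | IsVisiblePoint x}.ncard +
        ∑ q ∈ W, C * r ^ m * (1 / ((q : ℕ) : ℝ) ^ m) := by gcongr with q _; exact h3 q
    _ ≤ _ := by
      rw [← Finset.mul_sum]
      gcongr
      exact hs'.sum_le_tsum _ fun q _ => by positivity

/-! ### The infinite product and the density -/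

/-- From `1 - t ≤ exp (-t)`, partial products are at most the exponential of minus the partial sums.
-/
theorem hasProd_zero_of_not_summable {ι : Type*} {f : ι → ℝ} (h0 : ∀ i, 0 ≤ f i)
    (h1 : ∀ i, f i ≤ 1) (hf : ¬ Summable f) : HasProd (fun i => 1 - f i) 0 := by
  have hsum : Tendsto (fun T : Finset ι => ∑ i ∈ T, f i) atTop atTop := by
    refine tendsto_atTop_atTop_of_monotone
      (fun _ _ h => Finset.sum_le_sum_of_subset_of_nonneg h fun i _ _ => h0 i) fun b => ?_
    by_contra! hb
    exact hf (summable_of_sum_le h0 fun u => (hb u).le)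
  refine squeeze_zero (fun T => Finset.prod_nonneg fun i _ => sub_nonneg.2 (h1 i)) (fun T => ?_)
    (Real.tendsto_exp_neg_atTop_nhds_zero.comp hsum)
  simp only [Function.comp, ← Finset.sum_neg_distrib, Real.exp_sum]
  exact Finset.prod_le_prod (fun i _ => sub_nonneg.2 (h1 i))
    fun i _ => by linarith [Real.add_one_le_exp (-f i)]

theorem primesDividing_zero_nonempty : (primesDividing 0).Nonempty :=
  ⟨2, Nat.prime_two, dvd_zero _⟩

/-- Density of the visible points on a hyperplane given by a primitive equation. -/
theorem exists_hasProd_tendsto_visible_latticeSlice {m : ℕ} {a : Fin (m + 1) → ℤ}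
    (ha : Finset.univ.gcd a = 1) (d : ℤ) :
    ∃ ρ : ℝ, HasProd (fun q : primesDividing d => 1 - 1 / ((q : ℕ) : ℝ) ^ m) ρ ∧
      Tendsto (fun r : ℝ => ({x ∈ latticeSlice a d r | IsVisiblePoint x}.ncard : ℝ) /
        (latticeSlice a d r).ncard) atTop (𝓝 ρ) := by
  obtain ⟨V, hVpos, hV⟩ := tendsto_card_latticeSlice_zero ha
  obtain ⟨C, hC0, hC⟩ := exists_ncard_latticeSlice_diff_zero_le hV
  set vis : ℝ → ℝ := fun r => ({x ∈ latticeSlice a d r | IsVisiblePoint x}.ncard : ℝ) with hvis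
  have hle1 : ∀ q : primesDividing d, 1 / ((q : ℕ) : ℝ) ^ m ≤ 1 := fun q =>
    div_le_one_of_le₀ (one_le_pow₀ (by exact_mod_cast q.2.1.one_le)) (by positivity)
  have hnonneg : ∀ q : primesDividing d, 0 ≤ 1 / ((q : ℕ) : ℝ) ^ m := fun q => by positivity
  suffices ∃ ρ : ℝ, HasProd (fun q : primesDividing d => 1 - 1 / ((q : ℕ) : ℝ) ^ m) ρ ∧
      Tendsto (fun r : ℝ => vis r / r ^ m) atTop (𝓝 (V * ρ)) by
    obtain ⟨ρ, hρ, h⟩ := this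
    refine ⟨ρ, hρ, ?_⟩
    have h' := h.div (tendsto_card_latticeSlice ha hV d) hVpos.ne'
    rw [mul_div_cancel_left₀ _ hVpos.ne'] at h'
    refine h'.congr' ?_
    filter_upwards [eventually_gt_atTop 0] with r hr
    exact div_div_div_cancel_right₀ (by positivity) _ _
  set F : Finset (primesDividing d) → ℝ → ℝ := fun T r =>
    ({x ∈ latticeSlice a d r | ∀ q ∈ T, ¬ ∀ i, ((q : ℕ) : ℤ) ∣ x i}.ncard : ℝ) with hF
  have hFmap : ∀ T : Finset (primesDividing d), ∀ r,
      {x ∈ latticeSlice a d r | ∀ q ∈ T, ¬ ∀ i, ((q : ℕ) : ℤ) ∣ x i} =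
      {x ∈ latticeSlice a d r |
        ∀ q ∈ T.map (Function.Embedding.subtype _), ¬ ∀ i, (q : ℤ) ∣ x i} := fun T r => by
    simp only [Finset.forall_mem_map, Function.Embedding.subtype_apply]
  have hprime : ∀ T : Finset (primesDividing d),
      ∀ q ∈ T.map (Function.Embedding.subtype _), q.Prime := fun T => by
    simp only [Finset.forall_mem_map]
    exact fun q _ => q.2.1
  have hFlim : ∀ T, Tendsto (fun r => F T r / r ^ m) atTop
      (𝓝 (V * ∏ q ∈ T, (1 - 1 / ((q : ℕ) : ℝ) ^ m))) := fun T => by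
    simp only [hF, hFmap]
    convert tendsto_card_latticeSlice_not_dvd ha hV (hprime T) (d := d) ?_ using 3
    · rw [Finset.prod_map]
      rfl
    · simp only [Finset.forall_mem_map]
      exact fun q _ => q.2.2
  have hub : ∀ T r, vis r ≤ F T r := fun T r => by
    simp only [hF, hFmap]
    exact Nat.cast_le.2 (ncard_visible_le_ncard_not_dvd a d r (hprime T))
  have hupper : ∀ ρ, HasProd (fun q : primesDividing d => 1 - 1 / ((q : ℕ) : ℝ) ^ m) ρ →
      ∀ b > V * ρ, ∀ᶠ r in atTop, vis r / r ^ m < b := by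
    intro ρ hρ b hb
    obtain ⟨T, hT⟩ := ((hρ.const_mul V).eventually_lt_const hb).exists
    filter_upwards [(hFlim T).eventually_lt_const hT, eventually_gt_atTop 0] with r h hr
    exact (div_le_div_of_nonneg_right (hub T r) (by positivity)).trans_lt h
  -- Summability fails exactly when `d = 0` and `m ≤ 1`.
  by_cases hs : Summable fun q : primesDividing d => 1 / ((q : ℕ) : ℝ) ^ m
  · have hmul : Multipliable fun q : primesDividing d => 1 - 1 / ((q : ℕ) : ℝ) ^ m := by
      simpa only [sub_eq_add_neg] using Real.multipliable_one_add_of_summable hs.neg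
    obtain ⟨ρ, hρ⟩ := hmul
    refine ⟨ρ, hρ, tendsto_order.2 ⟨fun b hb => ?_, hupper ρ hρ⟩⟩
    have htail := (tendsto_tsum_compl_atTop_zero
      fun q : primesDividing d => 1 / ((q : ℕ) : ℝ) ^ m).const_mul C
    rw [mul_zero] at htail
    have hlim := (hρ.const_mul V).sub htail
    rw [sub_zero] at hlim
    have hne : ∀ᶠ T : Finset (primesDividing d) in atTop, d = 0 → T.Nonempty := by
      rcases eq_or_ne d 0 with rfl | hd
      · obtain ⟨q, hq⟩ := primesDividing_zero_nonempty
        filter_upwards [eventually_ge_atTop {⟨q, hq⟩}] with T hT _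
        exact ⟨_, hT (Finset.mem_singleton_self _)⟩
      · exact Eventually.of_forall fun T h => absurd h hd
    obtain ⟨T, hT, hTne⟩ := ((hlim.eventually_const_lt hb).and hne).exists
    filter_upwards [((hFlim T).sub_const _).eventually_const_lt hT, eventually_gt_atTop 0]
      with r h hr
    refine h.trans_le ?_
    have := ncard_not_dvd_le_ncard_visible_add hC0 hC hs hTne hr
    rw [sub_le_iff_le_add, div_add' _ _ _ (by positivity)]
    refine div_le_div_of_nonneg_right (this.trans_eq ?_) (by positivity)
    ring
  · have hρ := hasProd_zero_of_not_summable hnonneg hle1 hs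
    refine ⟨0, hρ, tendsto_order.2 ⟨fun b hb => ?_, hupper 0 hρ⟩⟩
    filter_upwards [eventually_gt_atTop 0] with r hr
    rw [mul_zero] at hb
    exact hb.trans_le (by positivity)

/-! ### Back to the hyperplane: dividing the equation by `g` -/

theorem latticePointsIn_hyperplaneThrough {n : ℕ} {p : Fin n → Fin n → ℤ}
    (hp : InGeneralPosition p) (r : ℝ) :
    latticePointsIn (hyperplaneThrough p) r =
      latticeSlice (hyperplaneCoeff p) (Matrix.of p).det r :=
  Set.ext fun x => and_congr_left' (toRealPoint_mem_hyperplaneThrough_iff hp x)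

theorem latticeSlice_mul_left {n : ℕ} (a : Fin n → ℤ) (d : ℤ) {g : ℤ} (hg : g ≠ 0) (r : ℝ) :
    latticeSlice (fun j => g * a j) (g * d) r = latticeSlice a d r := by
  refine Set.ext fun x => and_congr_left' ?_
  simp only [mul_assoc, ← Finset.mul_sum, ← mul_add, mul_eq_zero, or_iff_right hg]

theorem exists_visibleDensity_hyperplaneThrough {n : ℕ} (hn : 1 ≤ n) {p : Fin n → Fin n → ℤ}
    (hp : InGeneralPosition p) :
    ∃ ρ : ℝ,
      HasProd (fun q : primesDividing ((Matrix.of p).det / coeffGcd p) =>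
        1 - 1 / ((q : ℕ) : ℝ) ^ (n - 1)) ρ ∧
      HasVisibleDensity (hyperplaneThrough p) ρ := by
  obtain ⟨m, rfl⟩ := Nat.exists_eq_add_of_le' hn
  have hg := coeffGcd_ne_zero hn hp
  obtain ⟨a, ha, ha1⟩ := Finset.extract_gcd (hyperplaneCoeff p) (Finset.univ_nonempty)
  have hcoeff : hyperplaneCoeff p = fun j => coeffGcd p * a j :=
    funext fun j => ha j (Finset.mem_univ j)
  obtain ⟨ρ, hρ, h⟩ := exists_hasProd_tendsto_visible_latticeSlice ha1
    ((Matrix.of p).det / coeffGcd p)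
  refine ⟨ρ, hρ, h.congr fun r => ?_⟩
  have hslice : latticePointsIn (hyperplaneThrough p) r =
      latticeSlice a ((Matrix.of p).det / coeffGcd p) r := by
    rw [latticePointsIn_hyperplaneThrough hp, ← latticeSlice_mul_left a _ hg, ← hcoeff,
      Int.mul_ediv_cancel' (coeffGcd_dvd_det hn hp)]
  simp only [visiblePointsIn, hslice]

theorem corollary3p6 (n : ℕ) (hn : 1 ≤ n) (p : Fin n → Fin n → ℤ)
    (hp : InGeneralPosition p) :
    (coeffGcd p = 1 →
      ∃ ρ : ℝ,
        HasProd (fun q : primesDividing (Matrix.of p).det =>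
          1 - 1 / ((q : ℕ) : ℝ) ^ (n - 1)) ρ ∧
        HasVisibleDensity (hyperplaneThrough p) ρ) ∧
    ∃ ρ : ℝ,
      HasProd (fun q : primesDividing ((Matrix.of p).det / coeffGcd p) =>
        1 - 1 / ((q : ℕ) : ℝ) ^ (n - 1)) ρ ∧
      HasVisibleDensity (hyperplaneThrough p) ρ := by
  have h := exists_visibleDensity_hyperplaneThrough hn hp
  refine ⟨fun hg => ?_, h⟩
  rwa [hg, Int.ediv_one] at h
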